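/- All graphs are finite, simple and undirected. A tree-decomposition of a graph $G$ is a family $(B_x : x\in V(T))$ of subsets of $V(G)$ (bags), indexed by the nodes of a tree $T$, such that for every edge $uv$ of $G$ some bag contains both $u$ and $v$, and for every vertex $v$ of $G$ the set $\{x\in V(T) : v\in B_x\}$ induces a non-empty connected subtree of $T$. Its width is $\max_x |B_x| - 1$, and the treewidth of $G$ is the minimum width of a tree-decomposition of $G$. An $n$-colouring of $G$ assigns to each vertex one of $n$ colours; a monochromatic component is a connected component of the subgraph of $G$ induced by the vertices of one colour. A colouring has defect $d$ if every monochromatic component has maximum degree at most $d$, and clustering $c$ if every monochromatic component has at most $c$ vertices. For a class $\mathcal{G}$ of graphs, the defective chromatic number $\chi_{\Delta}(\mathcal{G})$ (respectively, the clustered chromatic number $\chi_{\star}(\mathcal{G})$) is the minimum integer $n$ for which there is an integer $d$ (respectively, $c$) such that every graph in $\mathcal{G}$ has an $n$-colouring with defect $d$ (respectively, clustering $c$). The (proper) chromatic number $\chi(\mathcal{G})$ is the maximum of the chromatic numbers $\chi(G)$ over $G\in\mathcal{G}$. Let $k\geq 1$ be an integer, and let $\mathcal{G}$ be the class of triangle-free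 graphs with treewidth at most $k$. Then $$\chi_{\Delta}(\mathcal{G}) = \chi_{\star}(\mathcal{G}) = \chi(\mathcal{G}) = \left\lceil \frac{k+3}{2} \right\rceil .$$ -/

import Mathlib

universe u

/-- A finite simple undirected graph. -/
structure FiniteGraph : Type (u + 1) where
  /-- the vertex set -/
  Vertex : Type u
  finite : Finite Vertex
  graph : SimpleGraph Vertex

/-- A tree-decomposition of `G`: a family of bags indexed by the nodes of a finite tree, such that
the two ends of each edge lie in a common bag, and for each vertex the nodes whose bags contain it
induce a non-empty connected subtree (`SimpleGraph.Connected` includes non-emptiness). -/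
structure TreeDecomposition {V : Type u} (G : SimpleGraph V) where
  Node : Type
  finite : Finite Node
  tree : SimpleGraph Node
  isTree : tree.IsTree
  bag : Node → Set V
  exists_bag_of_adj : ∀ v w : V, G.Adj v w → ∃ x, v ∈ bag x ∧ w ∈ bag x
  connected_nodes : ∀ v : V, (tree.induce {x | v ∈ bag x}).Connected

/-- The width of a tree-decomposition of a finite graph: the maximum size of a bag, minus one.
It is an integer, since the graph without vertices has a tree-decomposition of width `-1`. -/
noncomputable def TreeDecomposition.width {V : Type u} {G : SimpleGraph V}
    (D : TreeDecomposition G) : ℤ :=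
  ((⨆ x, (D.bag x).ncard : ℕ) : ℤ) - 1

/-- The treewidth of a finite graph: the minimum width of a tree-decomposition. -/
noncomputable def treewidth {V : Type u} (G : SimpleGraph V) : ℤ :=
  sInf (Set.range fun D : TreeDecomposition G => D.width)

/-- The subgraph of `G` induced by the vertices of colour `i`. Its connected components, for all
`i`, are the monochromatic components of the colouring `f`. -/
abbrev colourClass {V : Type u} (G : SimpleGraph V) {n : ℕ} (f : V → Fin n) (i : Fin n) :
    SimpleGraph {v | f v = i} :=
  G.induce {v | f v = i}

/-- The colouring `f` of a finite graph has defect `d`: in each monochromatic component, every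
vertex has degree at most `d`. -/
def HasDefect {V : Type u} (G : SimpleGraph V) {n : ℕ} (f : V → Fin n) (d : ℕ) : Prop :=
  ∀ (i : Fin n) (C : (colourClass G f i).ConnectedComponent) (v : C),
    (C.toSimpleGraph.neighborSet v).ncard ≤ d

/-- The colouring `f` of a finite graph has clustering `c`: each monochromatic component has at
most `c` vertices. -/
def HasClustering {V : Type u} (G : SimpleGraph V) {n : ℕ} (f : V → Fin n) (c : ℕ) : Prop :=
  ∀ (i : Fin n) (C : (colourClass G f i).ConnectedComponent), C.supp.ncard ≤ c

/-- The defective chromatic number of a graph class: the minimum `n` such that for some `d`, every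
graph in the class has an `n`-colouring with defect `d`; it is `⊤` (unbounded) if there is no
such `n`. -/
noncomputable def defectiveChromaticNumber (𝒢 : Set FiniteGraph.{u}) : ℕ∞ :=
  sInf {m : ℕ∞ | ∃ n : ℕ, m = n ∧ ∃ d : ℕ, ∀ G ∈ 𝒢, ∃ f : G.Vertex → Fin n, HasDefect G.graph f d}

/-- The clustered chromatic number of a graph class: the minimum `n` such that for some `c`, every
graph in the class has an `n`-colouring with clustering `c`; it is `⊤` (unbounded) if there is no
such `n`. -/
noncomputable def clusteredChromaticNumber (𝒢 : Set FiniteGraph.{u}) : ℕ∞ :=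
  sInf {m : ℕ∞ | ∃ n : ℕ, m = n ∧
    ∃ c : ℕ, ∀ G ∈ 𝒢, ∃ f : G.Vertex → Fin n, HasClustering G.graph f c}

/-- The (proper) chromatic number of a graph class: the maximum chromatic number of a graph in the
class; it is `⊤` (unbounded) if there is no maximum. -/
noncomputable def classChromaticNumber (𝒢 : Set FiniteGraph.{u}) : ℕ∞ :=
  ⨆ G ∈ 𝒢, G.graph.chromaticNumber

/-- The class of triangle-free finite graphs with treewidth at most `k`. -/
def triangleFreeTreewidthAtMost (k : ℕ) : Set FiniteGraph.{u} :=
  {G | G.graph.CliqueFree 3 ∧ treewidth G.graph ≤ k}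

/-!
Upper bound: let `D` be a tree-decomposition of width `k` of a triangle-free graph `G`, and let
`k + 3 ≤ 2 * n`. Colour the vertices greedily in the reverse of a perfect elimination ordering of
the chordal completion of `D`, so that no clique of the completion contains an independent set of
`G` with vertices of all `n` colours. A new vertex `v` has at most `k ≤ 2 * n - 3` earlier
neighbours in the completion; if no colour could be given to `v`, then for every colour `c` missing
on its earlier `G`-neighbours, the other earlier neighbours would contain an independent
transversal of the colours different from `c`. Some colour is then used at most once, and deleting
its vertex and the neighbours of that vertex leads to a contradiction by induction.

Lower bound: let `2 * n ≤ k + 2`. Given a decomposition of width `k` of a triangle-free graph,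
attach many new vertices to every independent subset of a bag, each with a new bag that consists of
the vertex and at most `k` vertices of the old bag. In a colouring with `n` colours and bounded
defect, one of the new vertices attached to a set avoids all colours of that set. Consider pairs
`(I, J)` of independent sets in a bag, each with pairwise distinct colours, such that `I` sees all
colours of `J`, and `J` is adjacent only to vertices of `I` whose colours appear on `J`. As long as
`I` misses a colour, `I ∪ J` has at most `2 * n - 2 ≤ k` vertices. A vertex attached to the part of
`I` coloured as in `J` then either enlarges `J`, or enlarges the set obtained from `I` by
exchanging that part for `J`. After boundedly many rounds `I` sees all colours, and the vertices
attached to `I` have none left.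
-/

section Transversals

variable {V C : Type*} {G : SimpleGraph V} {f : V → C}

/-- `H` contains an independent set of `G` on which `f` attains every colour of `P`. Repeated
colours and colours outside `P` are allowed. -/
def HasIndepTransversal (G : SimpleGraph V) (f : V → C) (H : Set V) (P : Set C) : Prop :=
  ∃ I ⊆ H, G.IsIndepSet I ∧ Set.SurjOn f I P

namespace HasIndepTransversal

theorem surjOn {H : Set V} {P : Set C} (h : HasIndepTransversal G f H P) : Set.SurjOn f H P := by
  obtain ⟨I, hIH, -, hI⟩ := h
  exact hI.mono hIH subset_rfl

theorem mono {H H' : Set V} {P : Set C} (h : HasIndepTransversal G f H P) (hH : H ⊆ H') :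
    HasIndepTransversal G f H' P := by
  obtain ⟨I, hIH, hind, hI⟩ := h
  exact ⟨I, hIH.trans hH, hind, hI⟩

theorem insert {H : Set V} {P : Set C} {y : V} (h : HasIndepTransversal G f H P)
    (hy : ∀ v ∈ H, ¬ G.Adj y v) :
    HasIndepTransversal G f (Insert.insert y H) (Insert.insert (f y) P) := by
  obtain ⟨I, hIH, hind, hI⟩ := h
  refine ⟨Insert.insert y I, Set.insert_subset_insert hIH, ?_, ?_⟩
  · exact Set.Pairwise.insert hind fun v hv _ => ⟨hy v (hIH hv), fun h => hy v (hIH hv) h.symm⟩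
  · rw [Set.SurjOn, Set.image_insert_eq]
    exact Set.insert_subset_insert hI

end HasIndepTransversal

/-- An independent transversal has to use a vertex `y` that is the only one of its colour, and the
rest of it avoids the neighbours of `y`. -/
theorem hasIndepTransversal_iff_of_unique_colour {H : Set V} {P : Set C} {y : V} (hyH : y ∈ H)
    (hyP : f y ∈ P) (hunique : ∀ z ∈ H, f z = f y → z = y) :
    HasIndepTransversal G f H P ↔
      HasIndepTransversal G f {v ∈ H | v ≠ y ∧ ¬ G.Adj y v} (P \ {f y}) := by
  constructor
  · rintro ⟨I, hIH, hind, hI⟩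
    have hyI : y ∈ I := by
      obtain ⟨z, hzI, hz⟩ := hI hyP
      rwa [← hunique z (hIH hzI) hz]
    refine ⟨I \ {y}, ?_, hind.mono Set.sdiff_subset, ?_⟩
    · exact fun v ⟨hvI, hvy⟩ => ⟨hIH hvI, hvy, hind hyI hvI (Ne.symm hvy)⟩
    · rintro c ⟨hcP, hcy⟩
      obtain ⟨v, hvI, rfl⟩ := hI hcP
      exact ⟨v, ⟨hvI, fun hv => hcy (congrArg f hv)⟩, rfl⟩
  · intro h
    have hins := h.insert (y := y) fun v hv => hv.2.2
    rw [Set.insert_sdiff_singleton, Set.insert_eq_of_mem hyP] at hins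
    exact hins.mono (Set.insert_subset hyH fun v hv => hv.1)

theorem exists_adj_of_not_hasIndepTransversal {H : Set V} {P : Set C} {y : V} (hyH : y ∈ H)
    (hyP : f y ∈ P) (hno : ¬ HasIndepTransversal G f H P)
    (hex : HasIndepTransversal G f H (P \ {f y})) : ∃ z ∈ H, G.Adj y z := by
  by_contra! hisolated
  have h := hex.insert hisolated
  rw [Set.insert_sdiff_singleton, Set.insert_eq_of_mem hyP, Set.insert_eq_of_mem hyH] at h
  exact hno h

theorem exists_mem_forall_eq_of_surjOn_erase [DecidableEq C] {H : Finset V} {P U : Finset C}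
    (hUP : U ⊆ P) (hU : U.Nonempty) (hsurj : ∀ c ∈ U, Set.SurjOn f H (P.erase c : Finset C))
    (hlt : H.card + 2 < P.card + U.card) :
    ∃ y ∈ H, f y ∈ P ∧ (U.erase (f y)).Nonempty ∧ ∀ z ∈ H, f z = f y → z = y := by
  have hUcard := Finset.card_le_card hUP
  have hU2 : 1 < U.card := by
    obtain ⟨c, hc⟩ := hU
    have h := Finset.card_le_card_of_surjOn f (hsurj c hc)
    rw [Finset.card_erase_of_mem (hUP hc)] at h
    omega
  obtain ⟨e, heP, he⟩ := Finset.exists_card_fiber_lt_of_card_lt_mul (s := H) (t := P) (f := f)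
    (n := 2) (by omega)
  obtain ⟨d, hdU, hde⟩ := Finset.exists_mem_ne hU2 e
  obtain ⟨y, hyH, rfl⟩ : ∃ y ∈ H, f y = e :=
    hsurj d hdU (Finset.mem_coe.2 (Finset.mem_erase.2 ⟨hde.symm, heP⟩))
  exact ⟨y, hyH, heP, ⟨d, Finset.mem_erase.2 ⟨hde, hdU⟩⟩, fun z hz hzy =>
    Finset.card_le_one.1 (Nat.le_of_lt_succ he) z (by simp [hz, hzy]) y (by simp [hyH])⟩

theorem card_add_card_le_of_forall_hasIndepTransversal_erase [DecidableEq C] (H : Finset V)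
    (P U : Finset C) (hUP : U ⊆ P) (hU : U.Nonempty) (hno : ¬ HasIndepTransversal G f H P)
    (hex : ∀ c ∈ U, HasIndepTransversal G f H (P.erase c : Finset C)) :
    P.card + U.card ≤ H.card + 2 := by
  classical
  induction P using Finset.strongInduction generalizing H U with
  | H P ih =>
  by_contra! hlt
  obtain ⟨y, hyH, hyP, hUy, hunique⟩ := exists_mem_forall_eq_of_surjOn_erase hUP hU
    (fun c hc => (hex c hc).surjOn) hlt
  set H' := {v ∈ H | v ≠ y ∧ ¬ G.Adj y v} with hH'
  have hreduce : ∀ Q : Finset C, f y ∈ Q → (HasIndepTransversal G f H Q ↔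
      HasIndepTransversal G f H' (Q.erase (f y) : Finset C)) := by
    intro Q hyQ
    simpa [hH'] using hasIndepTransversal_iff_of_unique_colour (G := G) (f := f)
      (H := H) (P := Q) hyH hyQ hunique
  have hbound := ih (P.erase (f y)) (Finset.erase_ssubset hyP) H' (U.erase (f y))
    (Finset.erase_subset_erase _ hUP) hUy (fun h => hno ((hreduce P hyP).2 h)) fun c hc => by
      obtain ⟨hcy, hcU⟩ := Finset.mem_erase.1 hc
      rw [Finset.erase_right_comm]
      exact (hreduce _ (Finset.mem_erase.2 ⟨hcy.symm, hyP⟩)).1 (hex c hcU)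
  have hH'_sub : H' ⊆ H.erase y := fun v hv => by
    obtain ⟨hvH, hvy, -⟩ := Finset.mem_filter.1 hv
    exact Finset.mem_erase.2 ⟨hvy, hvH⟩
  have hcardP := Finset.card_erase_add_one hyP
  have hcardH := Finset.card_erase_add_one hyH
  by_cases hyU : f y ∈ U
  · have hcardU := Finset.card_erase_add_one hyU
    obtain ⟨p, hpH, hyp⟩ :=
      exists_adj_of_not_hasIndepTransversal hyH hyP hno (by simpa using hex _ hyU)
    have hlt' : H'.card < (H.erase y).card := Finset.card_lt_card
      ⟨hH'_sub, fun h => (Finset.mem_filter.1 (h (Finset.mem_erase.2 ⟨hyp.ne', hpH⟩))).2.2 hyp⟩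
    omega
  · rw [Finset.erase_eq_of_notMem hyU] at hbound
    have hle' := Finset.card_le_card hH'_sub
    omega

/-- Provides the colour of a new vertex whose neighbourhood in the chordal supergraph is `B` and
whose neighbourhood in the graph is `N`. -/
theorem exists_notMem_image_not_hasIndepTransversal [Finite C] {B N : Set V} (hfin : B.Finite)
    (hB : B.ncard + 3 ≤ 2 * Nat.card C) (hNB : N ⊆ B) (hN : G.IsIndepSet N)
    (hno : ¬ HasIndepTransversal G f B Set.univ) :
    ∃ c ∉ f '' N, ¬ HasIndepTransversal G f (B \ N) {c}ᶜ := by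
  classical
  have := Fintype.ofFinite C
  lift N to Finset V using hfin.subset hNB
  lift B to Finset V using hfin
  rw [Set.ncard_coe_finset, Nat.card_eq_fintype_card] at hB
  rw [Finset.coe_subset] at hNB
  by_contra! hcon
  have hU : (N.image f)ᶜ.Nonempty := by
    rw [Finset.nonempty_iff_ne_empty, Ne, Finset.compl_eq_empty_iff]
    intro huniv
    refine hno ⟨N, Finset.coe_subset.2 hNB, hN, ?_⟩
    rw [Set.SurjOn, ← Finset.coe_image, huniv, Finset.coe_univ]
  have hcard := card_add_card_le_of_forall_hasIndepTransversal_erase (G := G) (f := f) (B \ N)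
    Finset.univ (N.image f)ᶜ (Finset.subset_univ _) hU
    (fun h => hno (by simpa using h.mono (Finset.coe_subset.2 Finset.sdiff_subset)))
    (fun c hc => by simpa [Set.compl_eq_univ_sdiff] using hcon c (by simpa using hc))
  rw [Finset.card_compl, Finset.card_univ, Finset.card_sdiff_of_subset hNB] at hcard
  have hNcard := Finset.card_le_card hNB
  have himage : (N.image f).card ≤ N.card := Finset.card_image_le
  omega

end Transversals

section Elimination

variable {V C : Type*} {G F : SimpleGraph V} {f : V → C} {S : Set V}

/-- Every nonempty finite set of vertices contains one whose neighbours in the set form a clique of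
size at most `k`. For finite graphs this means being chordal without cliques of size `k + 2`. -/
def IsSimplicialDegenerate (F : SimpleGraph V) (k : ℕ) : Prop :=
  ∀ S : Finset V, S.Nonempty →
    ∃ v ∈ S, F.IsClique (↑S ∩ F.neighborSet v) ∧ (↑S ∩ F.neighborSet v).ncard ≤ k

/-- The invariant of the greedy colouring of `G`: on `S`, the colouring is proper and no clique of
the supergraph `F` contains an independent set of `G` with vertices of all colours. -/
structure IsTransversalFreeColouring (G F : SimpleGraph V) (f : V → C) (S : Set V) : Prop where
  ne_of_adj : ∀ v ∈ S, ∀ w ∈ S, G.Adj v w → f v ≠ f w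
  not_surjOn : ∀ I ⊆ S, F.IsClique I → G.IsIndepSet I → ¬ Set.SurjOn f I Set.univ

namespace IsTransversalFreeColouring

theorem not_hasIndepTransversal (h : IsTransversalFreeColouring G F f S) {K : Set V} (hKS : K ⊆ S)
    (hK : F.IsClique K) : ¬ HasIndepTransversal G f K Set.univ :=
  fun ⟨I, hIK, hI, hsurj⟩ => h.not_surjOn I (hIK.trans hKS) (hK.subset hIK) hI hsurj

theorem update_insert [DecidableEq V] (h : IsTransversalFreeColouring G F f S) {v : V} {c : C}
    (hv : v ∉ S) (hc : c ∉ f '' (S ∩ G.neighborSet v))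
    (hno : ¬ HasIndepTransversal G f ((S ∩ F.neighborSet v) \ (S ∩ G.neighborSet v)) {c}ᶜ) :
    IsTransversalFreeColouring G F (Function.update f v c) (insert v S) where
  ne_of_adj := by
    have hupdate : ∀ w ∈ S, Function.update f v c w = f w := fun w hw =>
      Function.update_of_ne (ne_of_mem_of_not_mem hw hv) _ _
    have hcne : ∀ w ∈ S, G.Adj v w → f w ≠ c := fun w hw hvw hwc => hc ⟨w, ⟨hw, hvw⟩, hwc⟩
    rintro a (rfl | ha) b (rfl | hb) hab
    · exact (G.irrefl hab).elim
    · rw [Function.update_self, hupdate b hb]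
      exact (hcne b hb hab).symm
    · rw [Function.update_self, hupdate a ha]
      exact hcne a ha hab.symm
    · rw [hupdate a ha, hupdate b hb]
      exact h.ne_of_adj a ha b hb hab
  not_surjOn := by
    intro I hIS hclique hind hsurj
    have hIS' : I \ {v} ⊆ S := fun u ⟨huI, huv⟩ => (hIS huI).resolve_left huv
    by_cases hvI : v ∈ I
    · refine hno ⟨I \ {v}, ?_, hind.mono Set.sdiff_subset, ?_⟩
      · rintro u ⟨huI, huv⟩
        exact ⟨⟨hIS' ⟨huI, huv⟩, hclique hvI huI (Ne.symm huv)⟩,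
          fun hu => hind hvI huI (Ne.symm huv) hu.2⟩
      · intro a hac
        obtain ⟨u, huI, rfl⟩ := hsurj (Set.mem_univ a)
        have huv : u ≠ v := by
          rintro rfl
          exact hac (Function.update_self ..)
        exact ⟨u, ⟨huI, huv⟩, (Function.update_of_ne huv _ _).symm⟩
    · rw [Set.sdiff_singleton_eq_self hvI] at hIS'
      refine h.not_surjOn I hIS' hclique hind (hsurj.congr fun u hu => ?_)
      exact Function.update_of_ne (ne_of_mem_of_not_mem hu hvI) _ _

end IsTransversalFreeColouring

theorem exists_isTransversalFreeColouring [Finite C] {k : ℕ} (hG : G.CliqueFree 3) (hGF : G ≤ F)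
    (hF : IsSimplicialDegenerate F k) (hk : k + 3 ≤ 2 * Nat.card C) (S : Finset V) :
    ∃ f : V → C, IsTransversalFreeColouring G F f S := by
  classical
  induction S using Finset.strongInduction with
  | H S ih =>
  obtain rfl | hS := S.eq_empty_or_nonempty
  · obtain ⟨c⟩ : Nonempty C := (Nat.card_pos_iff.1 (by omega)).1
    refine ⟨fun _ => c, by simp, fun I hI _ _ hsurj => ?_⟩
    obtain ⟨v, hv, -⟩ := hsurj (Set.mem_univ c)
    simpa using hI hv
  obtain ⟨v, hv, hclique, hcard⟩ := hF S hS
  obtain ⟨f, hf⟩ := ih (S.erase v) (Finset.erase_ssubset hv)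
  have herase : ∀ H : SimpleGraph V,
      (↑(S.erase v) ∩ H.neighborSet v : Set V) = ↑S ∩ H.neighborSet v := fun H => by
    rw [Finset.coe_erase, Set.sdiff_inter_right_comm, Set.sdiff_singleton_eq_self (by simp)]
  rw [← herase] at hclique hcard
  obtain ⟨c, hcN, hc⟩ := exists_notMem_image_not_hasIndepTransversal (G := G) (f := f)
    ((S.erase v).finite_toSet.inter_of_left (F.neighborSet v)) (by omega)
    (Set.inter_subset_inter_right _ fun u hvu => hGF hvu)
    ((SimpleGraph.isIndepSet_neighborSet_of_triangleFree _ hG v).mono Set.inter_subset_right)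
    (hf.not_hasIndepTransversal Set.inter_subset_left hclique)
  rw [← Finset.insert_erase hv, Finset.coe_insert]
  exact ⟨_, hf.update_insert (by simp) hcN hc⟩

theorem colorable_of_isSimplicialDegenerate [Finite V] {k n : ℕ} (hG : G.CliqueFree 3)
    (hGF : G ≤ F) (hF : IsSimplicialDegenerate F k) (hk : k + 3 ≤ 2 * n) : G.Colorable n := by
  have := Fintype.ofFinite V
  obtain ⟨f, hf⟩ := exists_isTransversalFreeColouring (C := Fin n) hG hGF hF (by simpa using hk)
    Finset.univ
  exact ⟨SimpleGraph.Coloring.mk f fun {v w} hvw => hf.ne_of_adj v (by simp) w (by simp) hvw⟩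

end Elimination

section Trees

variable {N : Type*} {T : SimpleGraph N} {r a b x : N} {X Y : Set N}

/-- `a` is a vertex of `X` closest to `r`: the root that the subtree `X` of the tree `T` inherits
from the root `r` of `T`. -/
structure IsSubtreeRoot (T : SimpleGraph N) (r : N) (X : Set N) (a : N) : Prop where
  mem : a ∈ X
  dist_le : ∀ y ∈ X, T.dist r a ≤ T.dist r y

namespace IsSubtreeRoot

theorem exists_isPath_append (ha : IsSubtreeRoot T r X a) (hT : T.Connected)
    (hX : (T.induce X).Connected) (hx : x ∈ X) :
    ∃ (q : T.Walk r a) (p : T.Walk a x), (q.append p).IsPath ∧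
      (∀ y ∈ q.support, T.dist r a ≤ T.dist r y → y = a) ∧ ∀ y ∈ p.support, y ∈ X := by
  classical
  obtain ⟨q, hq, hqlen⟩ := hT.exists_path_of_dist r a
  obtain ⟨p₀, hp₀⟩ := (hX.preconnected ⟨a, ha.mem⟩ ⟨x, hx⟩).exists_isPath
  let p : T.Walk a x := p₀.map (SimpleGraph.Embedding.induce X).toHom
  have hp : p.IsPath := hp₀.map Subtype.val_injective
  have hqa : ∀ y ∈ q.support, T.dist r a ≤ T.dist r y → y = a := by
    intro y hy hle
    have hlen : (q.takeUntil y hy).length + (q.dropUntil y hy).length = q.length := by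
      rw [← SimpleGraph.Walk.length_append, SimpleGraph.Walk.take_spec]
    have hdist := SimpleGraph.dist_le (q.takeUntil y hy)
    exact SimpleGraph.Walk.eq_of_length_eq_zero (p := q.dropUntil y hy) (by omega)
  have hpX : ∀ y ∈ p.support, y ∈ X := by
    intro y hy
    obtain ⟨z, -, rfl⟩ := List.mem_map.1 (SimpleGraph.Walk.support_map _ p₀ ▸ hy)
    exact z.2
  refine ⟨q, p, ?_, hqa, hpX⟩
  rw [SimpleGraph.Walk.isPath_def, SimpleGraph.Walk.support_append, List.nodup_append']
  have hnodup := hp.support_nodup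
  rw [← SimpleGraph.Walk.cons_tail_support] at hnodup
  refine ⟨hq.support_nodup, hnodup.of_cons, fun y hyq hyp => ?_⟩
  rw [hqa y hyq (ha.dist_le y (hpX y (List.mem_of_mem_tail hyp)))] at hyp
  exact (List.nodup_cons.1 hnodup).1 hyp

/-- The path from `r` to a common vertex of the two subtrees passes through `a`, then through `b`,
and stays in `X` after `a`. -/
theorem mem_of_dist_le (ha : IsSubtreeRoot T r X a) (hb : IsSubtreeRoot T r Y b) (hT : T.IsTree)
    (hX : (T.induce X).Connected) (hY : (T.induce Y).Connected) (hXY : (X ∩ Y).Nonempty)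
    (hab : T.dist r a ≤ T.dist r b) : b ∈ X := by
  obtain ⟨x, hxX, hxY⟩ := hXY
  obtain ⟨q, p, hqp, hq, hp⟩ := ha.exists_isPath_append hT.connected hX hxX
  obtain ⟨q', p', hqp', -, -⟩ := hb.exists_isPath_append hT.connected hY hxY
  have heq : q'.append p' = q.append p :=
    congrArg Subtype.val ((hT.isAcyclic.subsingleton_path r x).elim ⟨_, hqp'⟩ ⟨_, hqp⟩)
  have hmem : b ∈ (q'.append p').support :=
    SimpleGraph.Walk.mem_support_append_iff _ _ |>.2 (.inl q'.end_mem_support)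
  rw [heq, SimpleGraph.Walk.mem_support_append_iff] at hmem
  obtain hbq | hbp := hmem
  · rw [hq b hbq hab]
    exact ha.mem
  · exact hp b hbp

end IsSubtreeRoot

end Trees

namespace TreeDecomposition

variable {V : Type u} {G : SimpleGraph V}

theorem width_le_iff (D : TreeDecomposition G) {k : ℕ} :
    D.width ≤ k ↔ ∀ x, (D.bag x).ncard ≤ k + 1 := by
  have := D.finite
  have : Nonempty D.Node := D.isTree.connected.nonempty
  rw [TreeDecomposition.width, sub_le_iff_le_add]
  norm_cast
  exact ciSup_le_iff (Set.finite_range _).bddAbove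

/-- The tree-decomposition with a single bag, containing all vertices. -/
def oneBag (G : SimpleGraph V) : TreeDecomposition G where
  Node := Unit
  finite := inferInstance
  tree := ⊥
  isTree := SimpleGraph.IsTree.of_subsingleton
  bag _ := Set.univ
  exists_bag_of_adj _ _ _ := ⟨(), Set.mem_univ _, Set.mem_univ _⟩
  connected_nodes v := by
    have : Nonempty {_x : Unit | v ∈ (Set.univ : Set V)} := ⟨⟨(), Set.mem_univ v⟩⟩
    exact SimpleGraph.Connected.of_subsingleton

/-- The chordal completion of a tree-decomposition: two vertices are adjacent if they share a
bag. -/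
def completion (D : TreeDecomposition G) : SimpleGraph V where
  Adj v w := v ≠ w ∧ ∃ x, v ∈ D.bag x ∧ w ∈ D.bag x
  symm := ⟨fun _ _ ⟨hne, x, hv, hw⟩ => ⟨hne.symm, x, hw, hv⟩⟩
  loopless := ⟨fun _ h => h.1 rfl⟩

theorem le_completion (D : TreeDecomposition G) : G ≤ D.completion :=
  fun v w h => ⟨h.ne, D.exists_bag_of_adj v w h⟩

theorem exists_isSubtreeRoot (D : TreeDecomposition G) (r : D.Node) (v : V) :
    ∃ a, IsSubtreeRoot D.tree r {x | v ∈ D.bag x} a := by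
  have := D.finite
  obtain ⟨x⟩ := (D.connected_nodes v).nonempty
  obtain ⟨a, ha, hmin⟩ :=
    Set.exists_min_image {x | v ∈ D.bag x} (D.tree.dist r) (Set.toFinite _) ⟨x, x.2⟩
  exact ⟨a, ha, hmin⟩

/-- In a rooted decomposition, the vertex whose subtree has the deepest root `t v` is simplicial:
its neighbours all lie in the bag at `t v`. -/
theorem isSimplicialDegenerate_completion [Finite V] (D : TreeDecomposition G) {k : ℕ}
    (hk : D.width ≤ k) : IsSimplicialDegenerate D.completion k := by
  intro S hS
  obtain ⟨r⟩ := D.isTree.connected.nonempty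
  choose t ht using D.exists_isSubtreeRoot r
  obtain ⟨v, hv, hmax⟩ := S.exists_max_image (fun v => D.tree.dist r (t v)) hS
  have hbag : ↑S ∩ D.completion.neighborSet v ⊆ D.bag (t v) := by
    rintro u ⟨hu, -, x, hvx, hux⟩
    exact (ht u).mem_of_dist_le (ht v) D.isTree (D.connected_nodes u) (D.connected_nodes v)
      ⟨x, hux, hvx⟩ (hmax u hu)
  refine ⟨v, hv, fun _ ha _ hb hab => ⟨hab, t v, hbag ha, hbag hb⟩, ?_⟩
  have hbag_insert : insert v (↑S ∩ D.completion.neighborSet v) ⊆ D.bag (t v) :=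
    Set.insert_subset (ht v).mem hbag
  have hcard := (Set.ncard_le_ncard hbag_insert).trans (D.width_le_iff.1 hk (t v))
  rw [Set.ncard_insert_of_notMem (by simp)] at hcard
  omega

end TreeDecomposition

section Treewidth

variable {V : Type u} {G : SimpleGraph V}

theorem treewidth_le_iff {z : ℤ} : treewidth G ≤ z ↔ ∃ D : TreeDecomposition G, D.width ≤ z := by
  have hbdd : BddBelow (Set.range fun D : TreeDecomposition G => D.width) := by
    refine ⟨-1, ?_⟩
    rintro _ ⟨D, rfl⟩
    exact le_sub_iff_add_le.2 (by simp)
  constructor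
  · intro h
    obtain ⟨D, hD⟩ :=
      Int.csInf_mem (Set.range_nonempty_iff_nonempty.2 ⟨TreeDecomposition.oneBag G⟩) hbdd
    exact ⟨D, hD.trans_le h⟩
  · rintro ⟨D, hD⟩
    exact (csInf_le hbdd ⟨D, rfl⟩).trans hD

theorem colorable_of_treewidth_le [Finite V] {k n : ℕ} (hG : G.CliqueFree 3)
    (hGk : treewidth G ≤ k) (hkn : k + 3 ≤ 2 * n) : G.Colorable n := by
  obtain ⟨D, hD⟩ := treewidth_le_iff.1 hGk
  exact colorable_of_isSimplicialDegenerate hG D.le_completion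
    (D.isSimplicialDegenerate_completion hD) hkn

end Treewidth

section AttachVertices

variable {V ι : Type*} {G : SimpleGraph V} {s : ι → Set V}

/-- The graph obtained from `G` by adding, for each `i : ι`, a new vertex with neighbourhood
`s i`. -/
def attachVertices (G : SimpleGraph V) (s : ι → Set V) : SimpleGraph (V ⊕ ι) where
  Adj
    | .inl v, .inl w => G.Adj v w
    | .inl v, .inr i => v ∈ s i
    | .inr i, .inl v => v ∈ s i
    | .inr _, .inr _ => False
  symm := ⟨by rintro (v | i) (w | j) h <;> first | exact h | exact SimpleGraph.Adj.symm (G := G) h⟩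
  loopless := ⟨by rintro (v | i) h <;> first | exact G.irrefl h | exact h⟩

@[simp] theorem attachVertices_adj_inl_inl {v w : V} :
    (attachVertices G s).Adj (.inl v) (.inl w) ↔ G.Adj v w :=
  Iff.rfl

@[simp] theorem attachVertices_adj_inl_inr {v : V} {i : ι} :
    (attachVertices G s).Adj (.inl v) (.inr i) ↔ v ∈ s i :=
  Iff.rfl

@[simp] theorem attachVertices_adj_inr_inl {v : V} {i : ι} :
    (attachVertices G s).Adj (.inr i) (.inl v) ↔ v ∈ s i :=
  Iff.rfl

@[simp] theorem not_attachVertices_adj_inr_inr {i j : ι} :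
    ¬ (attachVertices G s).Adj (.inr i) (.inr j) :=
  id

/-- The inclusion of `G` as an induced subgraph of `attachVertices G s`. -/
def attachEmbedding (G : SimpleGraph V) (s : ι → Set V) : G ↪g attachVertices G s where
  toFun := Sum.inl
  inj' := Sum.inl_injective
  map_rel_iff' := Iff.rfl

theorem attachVertices_cliqueFree_three (hG : G.CliqueFree 3) (hs : ∀ i, G.IsIndepSet (s i)) :
    (attachVertices G s).CliqueFree 3 := by
  classical
  have hind : ∀ i v w, v ∈ s i → w ∈ s i → ¬ G.Adj v w := fun i v w hv hw h =>
    hs i hv hw h.ne h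
  intro t ht
  obtain ⟨a, b, c, hab, hac, hbc, -⟩ := SimpleGraph.is3Clique_iff.1 ht
  rcases a with a | a <;> rcases b with b | b <;> rcases c with c | c <;>
    simp only [attachVertices_adj_inl_inl, attachVertices_adj_inl_inr, attachVertices_adj_inr_inl,
      not_attachVertices_adj_inr_inr] at hab hac hbc
  · exact hG {a, b, c} (SimpleGraph.is3Clique_triple_iff.2 ⟨hab, hac, hbc⟩)
  · exact hind _ _ _ hac hbc hab
  · exact hind _ _ _ hab hbc hac
  · exact hind _ _ _ hab hac hbc

theorem connected_of_hom_of_reachable {W : Type*} {H : SimpleGraph W} (hG : G.Connected)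
    (φ : G →g H) (hφ : ∀ y, ∃ x, H.Reachable (φ x) y) : H.Connected := by
  obtain ⟨r⟩ := hG.nonempty
  refine (SimpleGraph.connected_iff_exists_forall_reachable _).2 ⟨φ r, fun y => ?_⟩
  obtain ⟨x, hx⟩ := hφ y
  exact ((hG.preconnected r x).map φ).trans hx

theorem edgeSet_attachVertices_singleton (G : SimpleGraph V) (p : ι → V) :
    (attachVertices G fun i => {p i}).edgeSet =
      Sym2.map Sum.inl '' G.edgeSet ∪ Set.range fun i => s(.inl (p i), .inr i) := by
  ext e
  induction e with
  | _ a b =>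
  rcases a with a | i <;> rcases b with b | j
  · rw [← Sym2.map_mk, Set.mem_union, (Sym2.map.injective Sum.inl_injective).mem_set_image]
    simp
  · simp [Sym2.exists, eq_comm (a := a)]
  · simp [Sym2.exists, eq_comm (a := b)]
  · simp [Sym2.exists]

theorem isTree_attachVertices [Finite V] [Finite ι] (hG : G.IsTree) (p : ι → V) :
    (attachVertices G fun i => {p i}).IsTree := by
  have hconn : (attachVertices G fun i => {p i}).Connected := by
    refine connected_of_hom_of_reachable hG.connected (attachEmbedding G _).toHom ?_
    rintro (v | i)
    · exact ⟨v, .rfl⟩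
    · exact ⟨p i, SimpleGraph.Adj.reachable (Set.mem_singleton (p i))⟩
  refine SimpleGraph.isTree_iff_connected_and_card.2
    ⟨hconn, le_antisymm ?_ hconn.card_vert_le_card_edgeSet_add_one⟩
  rw [edgeSet_attachVertices_singleton, Nat.card_sum,
    ← (SimpleGraph.isTree_iff_connected_and_card.1 hG).2]
  have hunion := Set.ncard_union_le (Sym2.map (Sum.inl : V → V ⊕ ι) '' G.edgeSet)
    (Set.range fun i => s(.inl (p i), .inr i))
  have himage := Set.ncard_image_le (f := Sym2.map (Sum.inl : V → V ⊕ ι)) G.edgeSet.toFinite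
  have hrange := Finite.card_range_le fun i => s((Sum.inl (p i) : V ⊕ ι), .inr i)
  simp only [← Nat.card_coe_set_eq] at hunion himage
  omega

end AttachVertices

namespace TreeDecomposition

section Attach

variable {V : Type u} {G : SimpleGraph V} {N ι : Type} {B : N → Set V} {S s : ι → Set V}

/-- The bags `B`, together with a bag for each `i : ι` that consists of `S i` and the new vertex
`Sum.inr i`. -/
def attachBag (B : N → Set V) (S : ι → Set V) : N ⊕ ι → Set (V ⊕ ι)
  | .inl x => Sum.inl '' B x
  | .inr i => insert (.inr i) (Sum.inl '' S i)

@[simp] theorem inl_mem_attachBag_inl {v : V} {x : N} :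
    (.inl v : V ⊕ ι) ∈ attachBag B S (.inl x) ↔ v ∈ B x := by
  simp [attachBag]

@[simp] theorem inl_mem_attachBag_inr {v : V} {i : ι} :
    (.inl v : V ⊕ ι) ∈ attachBag B S (.inr i) ↔ v ∈ S i := by
  simp [attachBag]

@[simp] theorem inr_mem_attachBag {i : ι} {x : N ⊕ ι} :
    (.inr i : V ⊕ ι) ∈ attachBag B S x ↔ x = .inr i := by
  rcases x with x | j <;> simp [attachBag, eq_comm]

/-- The tree-decomposition of `attachVertices G s` obtained by attaching, for each `i : ι`, a leaf
to the node `p i`, whose bag consists of the part `S i` of the bag of `p i` and the new vertex. -/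
def attach [Finite ι] (D : TreeDecomposition G) (p : ι → D.Node) (S s : ι → Set V)
    (hS : ∀ i, S i ⊆ D.bag (p i)) (hs : ∀ i, s i ⊆ S i) :
    TreeDecomposition (attachVertices G s) where
  Node := D.Node ⊕ ι
  finite := by
    have := D.finite
    infer_instance
  tree := attachVertices D.tree fun i => {p i}
  isTree := by
    have := D.finite
    exact isTree_attachVertices D.isTree p
  bag := attachBag D.bag S
  exists_bag_of_adj := by
    rintro (v | i) (w | j) h
    · obtain ⟨x, hv, hw⟩ := D.exists_bag_of_adj v w h
      exact ⟨.inl x, inl_mem_attachBag_inl.2 hv, inl_mem_attachBag_inl.2 hw⟩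
    · exact ⟨.inr j, inl_mem_attachBag_inr.2 (hs j h), inr_mem_attachBag.2 rfl⟩
    · exact ⟨.inr i, inr_mem_attachBag.2 rfl, inl_mem_attachBag_inr.2 (hs i h)⟩
    · exact (not_attachVertices_adj_inr_inr h).elim
  connected_nodes := by
    rintro (v | i)
    · refine connected_of_hom_of_reachable (D.connected_nodes v)
        ⟨fun x => ⟨.inl x, inl_mem_attachBag_inl (S := S).2 x.2⟩, fun h => h⟩ ?_
      rintro ⟨x | i, hx⟩
      · exact ⟨⟨x, inl_mem_attachBag_inl (B := D.bag) (S := S) |>.1 hx⟩, .rfl⟩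
      · exact ⟨⟨p i, hS i (inl_mem_attachBag_inr (B := D.bag) (S := S) |>.1 hx)⟩,
          SimpleGraph.Adj.reachable (Set.mem_singleton (p i))⟩
    · have hnodes : {x | .inr i ∈ attachBag D.bag S x} = {.inr i} :=
        Set.ext fun x => inr_mem_attachBag
      rw [hnodes]
      exact SimpleGraph.Connected.of_subsingleton

theorem width_attach_le [Finite ι] {D : TreeDecomposition G} {k : ℕ} {p : ι → D.Node}
    (hS : ∀ i, S i ⊆ D.bag (p i)) (hs : ∀ i, s i ⊆ S i) (hD : D.width ≤ k)
    (hSk : ∀ i, (S i).ncard ≤ k) : (D.attach p S s hS hs).width ≤ k := by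
  rw [width_le_iff] at hD ⊢
  rintro (x | i)
  · exact (Set.ncard_image_of_injective _ Sum.inl_injective).trans_le (hD x)
  · refine (Set.ncard_insert_le _ _).trans (Nat.add_le_add_right ?_ 1)
    exact (Set.ncard_image_of_injective _ Sum.inl_injective).trans_le (hSk i)

end Attach

section Saturate

variable {V : Type} {G : SimpleGraph V} {k m : ℕ}

/-- The data for attaching a new vertex to a decomposition of width `k` of a triangle-free graph:
the neighbourhood `nbhd` of the new vertex, the set `support` of old vertices sharing a new bag with
it, and the node to which the new bag is attached. -/
@[ext]
structure AttachmentSite (D : TreeDecomposition G) (k : ℕ) where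
  node : D.Node
  support : Set V
  nbhd : Set V
  support_subset : support ⊆ D.bag node
  ncard_support_le : support.ncard ≤ k
  nbhd_subset : nbhd ⊆ support
  isIndepSet_nbhd : G.IsIndepSet nbhd

instance [Finite V] (D : TreeDecomposition G) : Finite (D.AttachmentSite k) := by
  have := D.finite
  refine Finite.of_injective
    (fun σ => (σ.node, σ.support, σ.nbhd) : D.AttachmentSite k → D.Node × Set V × Set V) ?_
  intro σ τ h
  simp only [Prod.mk.injEq] at h
  exact AttachmentSite.ext h.1 h.2.1 h.2.2

/-- The graph obtained by attaching `m` new vertices at each attachment site. -/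
abbrev saturatedGraph (D : TreeDecomposition G) (k m : ℕ) :
    SimpleGraph (V ⊕ D.AttachmentSite k × Fin m) :=
  attachVertices G fun i => i.1.nbhd

/-- The tree-decomposition obtained by attaching `m` new vertices at each attachment site. -/
def saturate [Finite V] (D : TreeDecomposition G) (k m : ℕ) :
    TreeDecomposition (D.saturatedGraph k m) :=
  D.attach (fun i : D.AttachmentSite k × Fin m => i.1.node) (fun i => i.1.support)
    (fun i => i.1.nbhd) (fun i => i.1.support_subset) fun i => i.1.nbhd_subset

theorem width_saturate_le [Finite V] {D : TreeDecomposition G} (hD : D.width ≤ k) :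
    (D.saturate k m).width ≤ k :=
  width_attach_le _ _ hD fun i => i.1.ncard_support_le

end Saturate

section Comap

variable {V : Type*} {W : Type*} {G : SimpleGraph V} {H : SimpleGraph W}

/-- The preimage of a tree-decomposition under a graph homomorphism. -/
def comap (D : TreeDecomposition G) (φ : H →g G) : TreeDecomposition H where
  Node := D.Node
  finite := D.finite
  tree := D.tree
  isTree := D.isTree
  bag x := φ ⁻¹' D.bag x
  exists_bag_of_adj _ _ h := D.exists_bag_of_adj _ _ (φ.map_adj h)
  connected_nodes v := D.connected_nodes (φ v)

theorem width_comap_le [Finite V] {D : TreeDecomposition G} {φ : H →g G} {k : ℕ}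
    (hφ : Function.Injective φ) (hD : D.width ≤ k) : (D.comap φ).width ≤ k := by
  rw [width_le_iff] at hD ⊢
  intro x
  rw [← Set.ncard_image_of_injective _ hφ]
  exact (Set.ncard_le_ncard (Set.image_preimage_subset _ _)).trans (hD x)

end Comap

end TreeDecomposition

section Defective

variable {V W C : Type*} {G : SimpleGraph V} {H : SimpleGraph W} {d : ℕ}

/-- Every vertex has at most `d` neighbours of its own colour. On finite graphs this is
`HasDefect`, for colours in an arbitrary type and without reference to components. -/
def IsDefective (G : SimpleGraph V) (f : V → C) (d : ℕ) : Prop :=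
  ∀ v, {u | G.Adj v u ∧ f u = f v}.ncard ≤ d

namespace IsDefective

theorem comp_embedding [Finite W] {f : W → C} (h : IsDefective H f d) (e : G ↪g H) :
    IsDefective G (f ∘ e) d := by
  intro v
  rw [← Set.ncard_image_of_injective _ e.injective]
  refine (Set.ncard_le_ncard ?_).trans (h (e v))
  rintro _ ⟨u, ⟨hvu, hfu⟩, rfl⟩
  exact ⟨e.map_adj_iff.2 hvu, hfu⟩

/-- If all `w i` had colours from `N`, some vertex of `N` would see its colour more than `d`
times. -/
theorem exists_notMem_image_of_forall_adj [Finite V] {f : V → C} (h : IsDefective G f d)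
    {ι : Type*} [Finite ι] {w : ι → V} (hw : Function.Injective w) {N : Set V}
    (hadj : ∀ i, ∀ u ∈ N, G.Adj u (w i)) (hcard : N.ncard * d < Nat.card ι) :
    ∃ i, f (w i) ∉ f '' N := by
  classical
  have := Fintype.ofFinite ι
  by_contra! hcon
  choose g hgN hg using hcon
  lift N to Finset V using N.toFinite
  rw [Set.ncard_coe_finset, Nat.card_eq_fintype_card] at hcard
  obtain ⟨u, hu, hlt⟩ := Finset.exists_lt_card_fiber_of_mul_lt_card_of_maps_to
    (s := Finset.univ) (f := g) (fun i _ => hgN i) hcard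
  refine (hlt.trans_le ?_).not_ge (h u)
  rw [← Finset.card_image_of_injective _ hw, ← Set.ncard_coe_finset]
  refine Set.ncard_le_ncard fun x hx => ?_
  obtain ⟨i, hi, rfl⟩ := Finset.mem_image.1 (Finset.mem_coe.1 hx)
  obtain rfl := (Finset.mem_filter.1 hi).2
  exact ⟨hadj i _ hu, (hg i).symm⟩

theorem exists_notMem_image_nbhd {V : Type} [Finite V] {G : SimpleGraph V}
    {D : TreeDecomposition G} {k m : ℕ} {f : V ⊕ D.AttachmentSite k × Fin m → C}
    (h : IsDefective (D.saturatedGraph k m) f d) (hm : k * d < m) (σ : D.AttachmentSite k) :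
    ∃ j, f (.inr (σ, j)) ∉ (f ∘ .inl) '' σ.nbhd := by
  rw [Set.image_comp]
  refine h.exists_notMem_image_of_forall_adj (w := fun j => .inr (σ, j))
    (Sum.inr_injective.comp (Prod.mk_right_injective σ)) ?_ ?_
  · rintro j _ ⟨u, hu, rfl⟩
    exact hu
  · rw [Set.ncard_image_of_injective _ Sum.inl_injective, Nat.card_fin]
    refine lt_of_le_of_lt (Nat.mul_le_mul_right d ?_) hm
    exact (Set.ncard_le_ncard σ.nbhd_subset).trans σ.ncard_support_le

end IsDefective

end Defective

section RainbowPairs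

variable {V W C : Type*} {G : SimpleGraph V} {H : SimpleGraph W} {f : V → C} {I J : Set V} {v : V}

/-- `I` is an independent set whose vertices have pairwise distinct colours. -/
structure IsRainbowIndepSet (G : SimpleGraph V) (f : V → C) (I : Set V) : Prop where
  isIndepSet : G.IsIndepSet I
  injOn : Set.InjOn f I

namespace IsRainbowIndepSet

theorem empty : IsRainbowIndepSet G f ∅ :=
  ⟨Set.pairwise_empty _, Set.injOn_empty _⟩

theorem mono (h : IsRainbowIndepSet G f J) (hIJ : I ⊆ J) : IsRainbowIndepSet G f I :=
  ⟨h.isIndepSet.mono hIJ, h.injOn.mono hIJ⟩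

theorem union (hI : IsRainbowIndepSet G f I) (hJ : IsRainbowIndepSet G f J)
    (hadj : ∀ v ∈ I, ∀ w ∈ J, ¬ G.Adj v w) (hf : Disjoint (f '' I) (f '' J)) :
    IsRainbowIndepSet G f (I ∪ J) where
  isIndepSet := Set.pairwise_union.2 ⟨hI.isIndepSet, hJ.isIndepSet, fun v hv w hw _ =>
    ⟨hadj v hv w hw, fun h => hadj v hv w hw h.symm⟩⟩
  injOn := (Set.injOn_union hf.of_image).2 ⟨hI.injOn, hJ.injOn, fun _ hv _ hw =>
    hf.ne_of_mem (Set.mem_image_of_mem f hv) (Set.mem_image_of_mem f hw)⟩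

theorem insert (hI : IsRainbowIndepSet G f I) (hadj : ∀ u ∈ I, ¬ G.Adj v u) (hf : f v ∉ f '' I) :
    IsRainbowIndepSet G f (insert v I) := by
  have hv : IsRainbowIndepSet G f {v} := ⟨Set.pairwise_singleton _ _, Set.injOn_singleton _ _⟩
  refine hv.union hI ?_ (by rwa [Set.image_singleton, Set.disjoint_singleton_left])
  rintro _ rfl
  exact hadj

theorem image {f : W → C} (e : G ↪g H) (hI : IsRainbowIndepSet G (f ∘ e) I) :
    IsRainbowIndepSet H f (e '' I) where
  isIndepSet := (e.injective.injOn.pairwise_image).2 fun _ hv _ hw hvw h =>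
    hI.isIndepSet hv hw hvw (e.map_adj_iff.1 h)
  injOn := hI.injOn.image_of_comp

end IsRainbowIndepSet

/-- Two disjoint rainbow independent sets such that every colour on `J` appears on `I`, and edges
between `J` and `I` only lead to vertices of `I` whose colour appears on `J`. So `J` may replace
the vertices of `I` having the same colours. -/
structure IsRainbowPair (G : SimpleGraph V) (f : V → C) (I J : Set V) : Prop where
  disjoint : Disjoint I J
  left : IsRainbowIndepSet G f I
  right : IsRainbowIndepSet G f J
  image_subset : f '' J ⊆ f '' I
  mem_image_of_adj : ∀ w ∈ J, ∀ u ∈ I, G.Adj w u → f u ∈ f '' J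

/-- Orders pairs of sets with at most `Nat.card C` vertices lexicographically by size. -/
noncomputable def rainbowPotential (C : Type*) (I J : Set V) : ℕ :=
  I.ncard * (Nat.card C + 1) + J.ncard

theorem IsRainbowIndepSet.isRainbowPair_empty (hI : IsRainbowIndepSet G f I) :
    IsRainbowPair G f I ∅ :=
  ⟨Set.disjoint_empty _, hI, .empty, by simp, by simp⟩

namespace IsRainbowPair

theorem image {f : W → C} (e : G ↪g H) (h : IsRainbowPair G (f ∘ e) I J) :
    IsRainbowPair H f (e '' I) (e '' J) where
  disjoint := (Set.disjoint_image_iff e.injective).2 h.disjoint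
  left := h.left.image
  right := h.right.image
  image_subset := by
    simpa only [Set.image_comp] using h.image_subset
  mem_image_of_adj := by
    rintro _ ⟨w, hw, rfl⟩ _ ⟨u, hu, rfl⟩ hadj
    rw [← Set.image_comp]
    exact h.mem_image_of_adj w hw u hu (e.map_adj_iff.1 hadj)

theorem ncard_left_le [Finite C] (h : IsRainbowPair G f I J) : I.ncard ≤ Nat.card C := by
  rw [← h.left.injOn.ncard_image]
  exact Set.ncard_le_card _

theorem ncard_right_le [Finite C] (h : IsRainbowPair G f I J) : J.ncard ≤ I.ncard := by
  rw [← h.left.injOn.ncard_image, ← h.right.injOn.ncard_image]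
  exact Set.ncard_le_ncard h.image_subset

theorem potential_le [Finite C] (h : IsRainbowPair G f I J) :
    rainbowPotential C I J ≤ Nat.card C * (Nat.card C + 1) + Nat.card C :=
  Nat.add_le_add (Nat.mul_le_mul_right _ h.ncard_left_le) (h.ncard_right_le.trans h.ncard_left_le)

theorem insert_right (h : IsRainbowPair G f I J) (hvI : v ∉ I)
    (hadjI : ∀ u ∈ I, G.Adj v u → f u ∈ f '' J) (hadjJ : ∀ u ∈ J, ¬ G.Adj v u)
    (hv : f v ∉ f '' J) (hvc : f v ∈ f '' I) : IsRainbowPair G f I (insert v J) where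
  disjoint := Set.disjoint_insert_right.2 ⟨hvI, h.disjoint⟩
  left := h.left
  right := h.right.insert hadjJ hv
  image_subset := by
    rw [Set.image_insert_eq]
    exact Set.insert_subset hvc h.image_subset
  mem_image_of_adj := by
    rw [Set.image_insert_eq]
    rintro w (rfl | hw) u hu hadj
    · exact .inr (hadjI u hu hadj)
    · exact .inr (h.mem_image_of_adj w hw u hu hadj)

/-- Replaces the vertices of `I` whose colour appears on `J` by `J`. -/
def exchange (f : V → C) (I J : Set V) : Set V :=
  J ∪ I \ f ⁻¹' (f '' J)

theorem isRainbowIndepSet_exchange (h : IsRainbowPair G f I J) :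
    IsRainbowIndepSet G f (exchange f I J) := by
  refine h.right.union (h.left.mono Set.sdiff_subset) ?_ ?_
  · exact fun w hw u hu hadj => hu.2 (h.mem_image_of_adj w hw u hu.1 hadj)
  · rw [Set.image_sdiff_preimage]
    exact Set.disjoint_sdiff_right

theorem image_exchange (h : IsRainbowPair G f I J) : f '' exchange f I J = f '' I := by
  rw [exchange, Set.image_union, Set.image_sdiff_preimage, Set.union_sdiff_cancel h.image_subset]

/-- If the colour of `v` appears on `I`, then `v` joins `J`. Otherwise `v` joins the exchanged set,
because it is only adjacent to vertices of `I` that have been exchanged. -/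
theorem exists_potential_lt [Finite C] (h : IsRainbowPair G f I J) (hvI : v ∉ I)
    (hadjI : ∀ u ∈ I, G.Adj v u → f u ∈ f '' J) (hadjJ : ∀ u ∈ J, ¬ G.Adj v u)
    (hv : f v ∉ f '' J) :
    ∃ I' ⊆ insert v (I ∪ J), ∃ J' ⊆ insert v (I ∪ J), IsRainbowPair G f I' J' ∧
      rainbowPotential C I J < rainbowPotential C I' J' := by
  by_cases hvc : f v ∈ f '' I
  · have hinsert := h.insert_right hvI hadjI hadjJ hv hvc
    refine ⟨I, Set.subset_union_left.trans (Set.subset_insert _ _), insert v J,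
      Set.insert_subset_insert Set.subset_union_right, hinsert, ?_⟩
    rw [rainbowPotential, rainbowPotential, ← h.right.injOn.ncard_image,
      ← hinsert.right.injOn.ncard_image, Set.image_insert_eq, Set.ncard_insert_of_notMem hv]
    omega
  · rw [← h.image_exchange] at hvc
    have hinsert := h.isRainbowIndepSet_exchange.insert (v := v)
      (fun u hu hadj => hu.elim (hadjJ u · hadj) fun hu => hu.2 (hadjI u hu.1 hadj)) hvc
    have hcard : (insert v (exchange f I J)).ncard = I.ncard + 1 := by
      rw [← hinsert.injOn.ncard_image, Set.image_insert_eq, Set.ncard_insert_of_notMem hvc,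
        h.image_exchange, h.left.injOn.ncard_image]
    refine ⟨insert v (exchange f I J), Set.insert_subset_insert ?_, ∅, Set.empty_subset _,
      hinsert.isRainbowPair_empty, ?_⟩
    · exact Set.union_subset Set.subset_union_right
        (Set.sdiff_subset.trans Set.subset_union_left)
    · have hJ := h.ncard_right_le.trans h.ncard_left_le
      rw [rainbowPotential, rainbowPotential, hcard, add_one_mul]
      omega

end IsRainbowPair

end RainbowPairs

section LowerBound

variable {V : Type} {C : Type*} {G : SimpleGraph V} {d k m t : ℕ}

/-- Some bag contains a rainbow pair of potential at least `t`. This is the invariant of the lower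
bound construction. -/
def TreeDecomposition.HasRainbowPair (D : TreeDecomposition G) (f : V → C) (t : ℕ) : Prop :=
  ∃ x, ∃ I ⊆ D.bag x, ∃ J ⊆ D.bag x, IsRainbowPair G f I J ∧ t ≤ rainbowPotential C I J

namespace TreeDecomposition

variable {D : TreeDecomposition G} {f : V ⊕ D.AttachmentSite k × Fin m → C} {x : D.Node}
  {I J : Set V}

/-- A new vertex attached to `I` avoids the colours of `I`, so these cannot be all colours. -/
theorem ncard_left_lt_of_isDefective_saturatedGraph [Finite V] [Finite C] (hC : Nat.card C ≤ k)
    (hf : IsDefective (D.saturatedGraph k m) f d) (hm : k * d < m) (hI : I ⊆ D.bag x)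
    (hIJ : IsRainbowPair G (f ∘ .inl) I J) : I.ncard < Nat.card C := by
  let σ : D.AttachmentSite k :=
    ⟨x, I, I, hI, hIJ.ncard_left_le.trans hC, subset_rfl, hIJ.left.isIndepSet⟩
  obtain ⟨j, hj⟩ := hf.exists_notMem_image_nbhd hm σ
  rw [← hIJ.left.injOn.ncard_image]
  exact Set.ncard_lt_card fun huniv => hj (huniv ▸ Set.mem_univ _)

/-- The new vertex is attached to the vertices of `I` whose colour appears on `J`, so that it avoids
the colours of `J` without being adjacent to `J`. -/
theorem HasRainbowPair.saturate [Finite V] [Finite C] (hC : 2 * Nat.card C ≤ k + 2)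
    (hCk : Nat.card C ≤ k) (hf : IsDefective (D.saturatedGraph k m) f d) (hm : k * d < m)
    (h : D.HasRainbowPair (f ∘ .inl) t) : (D.saturate k m).HasRainbowPair f (t + 1) := by
  obtain ⟨x, I, hI, J, hJ, hIJ, ht⟩ := h
  have hcard : (I ∪ J).ncard ≤ k := by
    have hlt := ncard_left_lt_of_isDefective_saturatedGraph hCk hf hm hI hIJ
    have hle := hIJ.ncard_right_le
    have hunion := Set.ncard_union_le I J
    omega
  let c : V → C := f ∘ .inl
  let σ : D.AttachmentSite k :=
    ⟨x, I ∪ J, I ∩ c ⁻¹' (c '' J), Set.union_subset hI hJ, hcard,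
      Set.inter_subset_left.trans Set.subset_union_left,
      hIJ.left.isIndepSet.mono Set.inter_subset_left⟩
  obtain ⟨j, hj⟩ := hf.exists_notMem_image_nbhd hm σ
  rw [Set.image_inter_preimage, Set.inter_eq_right.2 hIJ.image_subset, Set.image_comp] at hj
  have hpair : IsRainbowPair (D.saturatedGraph k m) f (.inl '' I) (.inl '' J) :=
    hIJ.image (attachEmbedding G _)
  have hadj : ∀ u, (D.saturatedGraph k m).Adj (.inr (σ, j)) (.inl u) ↔
      u ∈ I ∧ f (.inl u) ∈ f '' (.inl '' J) := by
    rw [← Set.image_comp]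
    exact fun u => Iff.rfl
  obtain ⟨I', hI', J', hJ', hIJ', hlt⟩ := hpair.exists_potential_lt (by simp)
    (by rintro _ ⟨u, -, rfl⟩ h; exact ((hadj u).1 h).2)
    (by rintro _ ⟨u, hu, rfl⟩ h; exact Set.disjoint_left.1 hIJ.disjoint ((hadj u).1 h).1 hu) hj
  have hbag : insert (.inr (σ, j)) (.inl '' I ∪ .inl '' J) ⊆ (D.saturate k m).bag (.inr (σ, j)) :=
    Set.insert_subset_insert (Set.image_union _ _ _).superset
  refine ⟨.inr (σ, j), I', hI'.trans hbag, J', hJ'.trans hbag, hIJ', ?_⟩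
  refine Nat.succ_le_of_lt (ht.trans_lt (lt_of_eq_of_lt ?_ hlt))
  simp only [rainbowPotential, Set.ncard_image_of_injective _ Sum.inl_injective]

theorem hasRainbowPair_zero (f : V → C) : D.HasRainbowPair f 0 := by
  have := D.isTree.connected.nonempty
  exact ⟨Classical.arbitrary _, ∅, Set.empty_subset _, ∅, Set.empty_subset _,
    IsRainbowIndepSet.empty.isRainbowPair_empty, Nat.zero_le _⟩

theorem exists_forall_isDefective_hasRainbowPair (C : Type*) [Finite C]
    (hC : 2 * Nat.card C ≤ k + 2) (hCk : Nat.card C ≤ k) (d t : ℕ) :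
    ∃ (V : Type) (_ : Finite V) (G : SimpleGraph V) (D : TreeDecomposition G),
      G.CliqueFree 3 ∧ D.width ≤ k ∧ ∀ f : V → C, IsDefective G f d → D.HasRainbowPair f t := by
  induction t with
  | zero =>
    refine ⟨Empty, inferInstance, ⊥, oneBag _, ?_, ?_, fun f _ => hasRainbowPair_zero f⟩
    · exact SimpleGraph.cliqueFree_of_card_lt (by simp)
    · exact (width_le_iff _).2 fun x => by
        rw [Set.eq_empty_of_isEmpty ((oneBag _).bag x), Set.ncard_empty]
        exact Nat.zero_le _
  | succ t ih =>
    obtain ⟨V, hV, G, D, hG, hD, hpair⟩ := ih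
    have hG' := attachVertices_cliqueFree_three hG
      fun i : D.AttachmentSite k × Fin (k * d + 1) => i.1.isIndepSet_nbhd
    refine ⟨_, inferInstance, D.saturatedGraph k (k * d + 1), D.saturate k _, hG',
      width_saturate_le hD, fun f hf => ?_⟩
    exact (hpair _ (hf.comp_embedding (attachEmbedding G _))).saturate hC hCk hf
      (Nat.lt_succ_self _)

end TreeDecomposition

theorem exists_forall_not_isDefective (C : Type*) [Finite C] (hC : 2 * Nat.card C ≤ k + 2)
    (hCk : Nat.card C ≤ k) (d : ℕ) :
    ∃ G ∈ triangleFreeTreewidthAtMost.{u} k, ∀ f : G.Vertex → C, ¬ IsDefective G.graph f d := by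
  obtain ⟨V, _, G, D, hG, hD, hpair⟩ :=
    TreeDecomposition.exists_forall_isDefective_hasRainbowPair C hC hCk d
      (Nat.card C * (Nat.card C + 1) + Nat.card C + 1)
  let e : G.comap (Equiv.ulift.{u} : ULift V ≃ V) ≃g G := SimpleGraph.Iso.comap Equiv.ulift G
  refine ⟨⟨ULift.{u} V, inferInstance, G.comap Equiv.ulift⟩, ⟨?_, ?_⟩, fun f hf => ?_⟩
  · exact hG.comap e.toEmbedding.toCopy.isContained
  · exact treewidth_le_iff.2
      ⟨D.comap e.toHom, TreeDecomposition.width_comap_le e.injective hD⟩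
  · have : Finite (ULift.{u} V) := inferInstance
    obtain ⟨x, I, -, J, -, hIJ, ht⟩ := hpair _ (hf.comp_embedding e.symm.toEmbedding)
    exact (hIJ.potential_le.trans_lt (Nat.lt_succ_self _)).not_ge ht

theorem add_three_le_of_forall_exists_isDefective {n : ℕ} (hk : 1 ≤ k)
    (h : ∀ G ∈ triangleFreeTreewidthAtMost.{u} k, ∃ f : G.Vertex → Fin n,
      IsDefective G.graph f d) : k + 3 ≤ 2 * n := by
  by_contra! hlt
  obtain ⟨G, hG, hno⟩ := exists_forall_not_isDefective.{u} (k := k) (Fin n)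
    (by rw [Nat.card_fin]; omega) (by rw [Nat.card_fin]; omega) d
  obtain ⟨f, hf⟩ := h G hG
  exact hno f hf

end LowerBound

section ChromaticNumbers

variable {V : Type u} {G : SimpleGraph V} {n : ℕ} {𝒢 : Set FiniteGraph.{u}}

theorem HasDefect.isDefective [Finite V] {f : V → Fin n} {d : ℕ} (h : HasDefect G f d) :
    IsDefective G f d := by
  intro v
  let v' : {w | f w = f v} := ⟨v, rfl⟩
  let C := (colourClass G f (f v)).connectedComponentMk v'
  refine le_trans ?_ (h (f v) C ⟨v', rfl⟩)
  rw [← Set.ncard_image_of_injective _ (Subtype.val_injective.comp Subtype.val_injective)]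
  refine Set.ncard_le_ncard ?_
  rintro u ⟨hvu, hu⟩
  have hadj : (colourClass G f (f v)).Adj v' ⟨u, hu⟩ := hvu
  exact ⟨⟨⟨u, hu⟩, SimpleGraph.ConnectedComponent.sound hadj.symm.reachable⟩, hvu, rfl⟩

theorem HasClustering.hasDefect [Finite V] {f : V → Fin n} {c : ℕ} (h : HasClustering G f c) :
    HasDefect G f c := by
  intro i C v
  refine le_trans (Set.ncard_le_card _) ?_
  exact h i C

theorem hasClustering_one_of_coloring [Finite V] (f : G.Coloring (Fin n)) :
    HasClustering G f 1 := by
  intro i C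
  have hbot : colourClass G f i = ⊥ := by
    rw [eq_bot_iff]
    intro v w h
    exact f.valid h (v.2.trans w.2.symm)
  refine Set.ncard_le_one_iff_subsingleton.2 fun v hv w hw => ?_
  have hreach : (colourClass G f i).Reachable v w :=
    SimpleGraph.ConnectedComponent.exact (hv.trans hw.symm)
  rwa [hbot, SimpleGraph.reachable_bot] at hreach

theorem defectiveChromaticNumber_le_clusteredChromaticNumber :
    defectiveChromaticNumber 𝒢 ≤ clusteredChromaticNumber 𝒢 := by
  refine sInf_le_sInf ?_
  rintro _ ⟨n, rfl, c, h⟩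
  refine ⟨n, rfl, c, fun G hG => ?_⟩
  have := G.finite
  exact (h G hG).imp fun _ hf => hf.hasDefect

theorem classChromaticNumber_le_iff :
    classChromaticNumber 𝒢 ≤ n ↔ ∀ G ∈ 𝒢, G.graph.Colorable n := by
  simp only [classChromaticNumber, iSup₂_le_iff, SimpleGraph.chromaticNumber_le_iff_colorable]

theorem clusteredChromaticNumber_le_classChromaticNumber :
    clusteredChromaticNumber 𝒢 ≤ classChromaticNumber 𝒢 := by
  cases hn : classChromaticNumber 𝒢 with
  | top => exact le_top
  | coe n =>
    refine sInf_le ⟨n, rfl, 1, fun G hG => ?_⟩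
    have := G.finite
    obtain ⟨f⟩ := classChromaticNumber_le_iff.1 hn.le G hG
    exact ⟨f, hasClustering_one_of_coloring f⟩

theorem natCeil_add_three_div_two_le_iff {k : ℕ} : ⌈((k : ℚ) + 3) / 2⌉₊ ≤ n ↔ k + 3 ≤ 2 * n := by
  rw [Nat.ceil_le, div_le_iff₀ two_pos, mul_comm]
  norm_cast

theorem le_defectiveChromaticNumber_triangleFreeTreewidthAtMost {k : ℕ} (hk : 1 ≤ k) :
    ⌈((k : ℚ) + 3) / 2⌉₊ ≤ defectiveChromaticNumber (triangleFreeTreewidthAtMost.{u} k) := by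
  refine le_sInf ?_
  rintro _ ⟨n, rfl, d, h⟩
  rw [Nat.cast_le, natCeil_add_three_div_two_le_iff]
  refine add_three_le_of_forall_exists_isDefective hk (d := d) fun G hG => ?_
  have := G.finite
  exact (h G hG).imp fun _ hf => hf.isDefective

theorem classChromaticNumber_triangleFreeTreewidthAtMost_le (k : ℕ) :
    classChromaticNumber (triangleFreeTreewidthAtMost.{u} k) ≤ ⌈((k : ℚ) + 3) / 2⌉₊ := by
  refine classChromaticNumber_le_iff.2 fun G ⟨hG, hGk⟩ => ?_
  have := G.finite
  exact colorable_of_treewidth_le hG hGk (natCeil_add_three_div_two_le_iff.1 le_rfl)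

end ChromaticNumbers

theorem mainTheorem2 (k : ℕ) (hk : 1 ≤ k) :
    defectiveChromaticNumber (triangleFreeTreewidthAtMost.{u} k) = (⌈((k : ℚ) + 3) / 2⌉₊ : ℕ∞) ∧
    clusteredChromaticNumber (triangleFreeTreewidthAtMost.{u} k) = (⌈((k : ℚ) + 3) / 2⌉₊ : ℕ∞) ∧
    classChromaticNumber (triangleFreeTreewidthAtMost.{u} k) = (⌈((k : ℚ) + 3) / 2⌉₊ : ℕ∞) := by
  have hlower := le_defectiveChromaticNumber_triangleFreeTreewidthAtMost.{u} hk
  have hupper := classChromaticNumber_triangleFreeTreewidthAtMost_le.{u} k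
  have hdefective := defectiveChromaticNumber_le_clusteredChromaticNumber
    (𝒢 := triangleFreeTreewidthAtMost.{u} k)
  have hclustered := clusteredChromaticNumber_le_classChromaticNumber
    (𝒢 := triangleFreeTreewidthAtMost.{u} k)
  exact ⟨le_antisymm (hdefective.trans (hclustered.trans hupper)) hlower,
    le_antisymm (hclustered.trans hupper) (hlower.trans hdefective),
    le_antisymm hupper (hlower.trans (hdefective.trans hclustered))⟩
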